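/- Let $S$ be a (non-empty) semigroup, let $\sigma:S\to S$ be an involutive automorphism, i.e. $\sigma(xy)=\sigma(x)\sigma(y)$ and $\sigma(\sigma(x))=x$ for all $x,y\in S$, and let $\alpha\in\mathbb{C}$. A function $\chi:S\to\mathbb{C}$ is called multiplicative if $\chi(xy)=\chi(x)\chi(y)$ for all $x,y\in S$ (the zero function is allowed). For $k:S\to\mathbb{C}$ put $k^*:=k\circ\sigma$, and call $k$ even if $k=k^*$. Call $k$ abelian if $k(xy)=k(yx)$ and $k(xyz)=k(xzy)$ for all $x,y,z\in S$. Put $S^2:=\{xy\mid x,y\in S\}$. A pair of functions $g,f:S\to\mathbb{C}$ satisfies $$g(x\sigma(y))=g(x)g(y)-f(x)f(y)+\alpha f(x\sigma(y))\quad\text{for all }x,y\in S$$ if and only if it belongs to at least one of the following families: 1. $\alpha=\pm1$, $f$ is any non-zero function and $g=\alpha f$. 2. $\alpha\neq1$, $f=g\neq0$ and $g=0$ on $S^2$. 3. $\alpha\neq-1$, $f=-g\neq0$ and $g=0$ on $S^2$. 4. $f=(q+\alpha)\dfrac{\chi}{2}$ and $g=\left(1\pm\sqrt{1+q^2-\alpha^2}\right)\dfrac{\chi}{2}$,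 where $q\in\mathbb{C}$ is a constant and $\chi:S\to\mathbb{C}$ is a non-zero even multiplicative function. 5. $f=\alpha\dfrac{\chi_1+\chi_2}{2}+q\dfrac{\chi_1-\chi_2}{2}$ and $g=\dfrac{\chi_1+\chi_2}{2}\pm\sqrt{1+q^2-\alpha^2}\,\dfrac{\chi_1-\chi_2}{2}$, where $\chi_1,\chi_2:S\to\mathbb{C}$ are two different non-zero even multiplicative functions and $q\in\mathbb{C}\setminus\{\pm\alpha\}$ is a constant. 6. $\alpha\neq0$, $f=\alpha\chi_1$ and $g=\chi_2$, where $\chi_1,\chi_2:S\to\mathbb{C}$ are two different non-zero even multiplicative functions. 7. $f=\alpha\chi+h$ and $g=\chi\pm h$, where $\chi:S\to\mathbb{C}$ is a non-zero even multiplicative function and $h:S\to\mathbb{C}$ is an even solution of $h(xy)=h(x)\chi(y)+h(y)\chi(x)$ for all $x,y\in S$. 8. $\alpha\neq\pm1$, $f=\dfrac{1+\alpha}{2}\chi-\dfrac{1-\alpha}{2}\chi^*$ and $g=\dfrac{1+\alpha}{2}\chi+\dfrac{1-\alpha}{2}\chi^*$, where $\chi:S\to\mathbb{C}$ is a multiplicative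 function such that $\chi\neq\chi^*$. In the families (2)–(8) both $g$ and $f$ are abelian. Moreover, if $S$ is a topological semigroup and $(g,f)$ is a solution such that $f$ is continuous and $f\neq\alpha\chi$ for every continuous multiplicative function $\chi:S\to\mathbb{C}$, then $g$ is continuous. -/

import Mathlib

namespace CosineLaw

/-- The functional equation `g(xσ(y)) = g(x)g(y) - f(x)f(y) + α f(xσ(y))` for all `x, y`. -/
def IsSolution {S : Type*} [Semigroup S] (σ : S ≃* S) (α : ℂ) (g f : S → ℂ) : Prop :=
  ∀ x y : S, g (x * σ y) = g x * g y - f x * f y + α * f (x * σ y)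

/-- `f` is even (with respect to `σ`): `f ∘ σ = f`. -/
def IsEven {S : Type*} [Semigroup S] (σ : S ≃* S) (f : S → ℂ) : Prop :=
  ∀ x : S, f (σ x) = f x

/-- `f` vanishes on `S² = {xy | x, y ∈ S}`. -/
def VanishesOnProducts {S : Type*} [Semigroup S] (f : S → ℂ) : Prop :=
  ∀ x y : S, f (x * y) = 0

/-- `f` is central: `f(xy) = f(yx)`. -/
def IsCentral {S : Type*} [Semigroup S] (f : S → ℂ) : Prop :=
  ∀ x y : S, f (x * y) = f (y * x)

/-- `f` is abelian: it is central and `f(xyz) = f(xzy)`. -/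
def IsAbelian {S : Type*} [Semigroup S] (f : S → ℂ) : Prop :=
  IsCentral f ∧ ∀ x y z : S, f (x * y * z) = f (x * z * y)

/-- The special sine addition law `h(xy) = h(x)χ(y) + h(y)χ(x)`. -/
def SineLaw {S : Type*} [Semigroup S] (χ : S →ₙ* ℂ) (h : S → ℂ) : Prop :=
  ∀ x y : S, h (x * y) = h x * χ y + h y * χ x

/-- Family (1): `α = ±1`, `f` is any non-zero function and `g = αf`. -/
def Family1 {S : Type*} (α : ℂ) (g f : S → ℂ) : Prop :=
  (α = 1 ∨ α = -1) ∧ f ≠ 0 ∧ ∀ x, g x = α * f x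

/-- Family (2): `α ≠ 1`, `f = g ≠ 0` and `g = 0` on `S²`. -/
def Family2 {S : Type*} [Semigroup S] (α : ℂ) (g f : S → ℂ) : Prop :=
  α ≠ 1 ∧ f = g ∧ g ≠ 0 ∧ VanishesOnProducts g

/-- Family (3): `α ≠ -1`, `f = -g ≠ 0` and `g = 0` on `S²`. -/
def Family3 {S : Type*} [Semigroup S] (α : ℂ) (g f : S → ℂ) : Prop :=
  α ≠ -1 ∧ f = -g ∧ g ≠ 0 ∧ VanishesOnProducts g

/-- Family (4): `f = (q + α)χ/2`, `g = (1 ± √(1 + q² - α²))χ/2`. Here `r` runs through the two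
complex square roots of `1 + q² - α²`, which accounts for the sign `±`. -/
def Family4 {S : Type*} [Semigroup S] (σ : S ≃* S) (α : ℂ) (g f : S → ℂ) : Prop :=
  ∃ (q r : ℂ) (χ : S →ₙ* ℂ), r ^ 2 = 1 + q ^ 2 - α ^ 2 ∧
    (χ : S → ℂ) ≠ 0 ∧ IsEven σ χ ∧
    (∀ x, f x = (q + α) * (χ x / 2)) ∧
    (∀ x, g x = (1 + r) * (χ x / 2))

/-- Family (5): `f = α(χ₁ + χ₂)/2 + q(χ₁ - χ₂)/2`,
`g = (χ₁ + χ₂)/2 ± √(1 + q² - α²)(χ₁ - χ₂)/2`. Again `r` runs through the two complex square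
roots of `1 + q² - α²`. -/
def Family5 {S : Type*} [Semigroup S] (σ : S ≃* S) (α : ℂ) (g f : S → ℂ) : Prop :=
  ∃ (q r : ℂ) (χ₁ χ₂ : S →ₙ* ℂ), r ^ 2 = 1 + q ^ 2 - α ^ 2 ∧
    q ≠ α ∧ q ≠ -α ∧ χ₁ ≠ χ₂ ∧
    (χ₁ : S → ℂ) ≠ 0 ∧ (χ₂ : S → ℂ) ≠ 0 ∧ IsEven σ χ₁ ∧ IsEven σ χ₂ ∧
    (∀ x, f x = α * ((χ₁ x + χ₂ x) / 2) + q * ((χ₁ x - χ₂ x) / 2)) ∧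
    (∀ x, g x = (χ₁ x + χ₂ x) / 2 + r * ((χ₁ x - χ₂ x) / 2))

/-- Family (6): `α ≠ 0`, `f = αχ₁`, `g = χ₂`. -/
def Family6 {S : Type*} [Semigroup S] (σ : S ≃* S) (α : ℂ) (g f : S → ℂ) : Prop :=
  α ≠ 0 ∧ ∃ χ₁ χ₂ : S →ₙ* ℂ, χ₁ ≠ χ₂ ∧
    (χ₁ : S → ℂ) ≠ 0 ∧ (χ₂ : S → ℂ) ≠ 0 ∧ IsEven σ χ₁ ∧ IsEven σ χ₂ ∧
    (∀ x, f x = α * χ₁ x) ∧ (∀ x, g x = χ₂ x)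

/-- Family (7): `f = αχ + h`, `g = χ ± h` with `h` an even solution of the special sine
addition law. -/
def Family7 {S : Type*} [Semigroup S] (σ : S ≃* S) (α : ℂ) (g f : S → ℂ) : Prop :=
  ∃ (χ : S →ₙ* ℂ) (h : S → ℂ),
    (χ : S → ℂ) ≠ 0 ∧ IsEven σ χ ∧ IsEven σ h ∧ SineLaw χ h ∧
    (∀ x, f x = α * χ x + h x) ∧
    ((∀ x, g x = χ x + h x) ∨ (∀ x, g x = χ x - h x))

/-- Family (8): `α ≠ ±1`, `f = (1+α)/2 χ - (1-α)/2 χ*`, `g = (1+α)/2 χ + (1-α)/2 χ*`, where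
`χ* = χ ∘ σ` and `χ ≠ χ*`. -/
def Family8 {S : Type*} [Semigroup S] (σ : S ≃* S) (α : ℂ) (g f : S → ℂ) : Prop :=
  α ≠ 1 ∧ α ≠ -1 ∧ ∃ χ : S →ₙ* ℂ, (χ : S → ℂ) ≠ χ ∘ σ ∧
    (∀ x, f x = (1 + α) / 2 * χ x - (1 - α) / 2 * χ (σ x)) ∧
    (∀ x, g x = (1 + α) / 2 * χ x + (1 - α) / 2 * χ (σ x))

/-- The pair `(g, f)` belongs to one of the families (2) to (8). -/
def NonExceptional {S : Type*} [Semigroup S] (σ : S ≃* S) (α : ℂ) (g f : S → ℂ) : Prop :=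
  Family2 α g f ∨ Family3 α g f ∨ Family4 σ α g f ∨ Family5 σ α g f ∨
    Family6 σ α g f ∨ Family7 σ α g f ∨ Family8 σ α g f

end CosineLaw

/-! Put F = g - αf. The equation says F(xy) = g(x)g(σy) - f(x)f(σy). The right side is unchanged
under (x, y) ↦ (σy, σx), and this makes F cyclic on triple products.

If g and f are independent, their span V is therefore stable under left and right translations and
under σ (`translates`, `comp_mem`). Hence multiplication in S turns the dual of V into a
two-dimensional associative algebra, and the expression of F through g∘σ and f∘σ supplies its
two-sided unit (`exists_unit`). Such an algebra over ℂ is ℂ × ℂ or ℂ[ε]/(ε²). Dually, V is spanned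
by two multiplicative functions, or by one and a solution of its sine law
(`exists_exponential_basis`). In the first case σ fixes both multiplicative functions or swaps them.
Comparing coefficients gives families 5 and 6 (fixed), 8 (swapped) and 7 (sine law).

If g and f are dependent, both are multiples of one k, and the equation becomes c·k(xσy) =
m·k(x)k(y), which leads to families 1 to 4 (`family_of_smul`).

For continuity, translates of f recover the basis functions that make up g. -/

namespace CosineLaw

/-! ### Linear algebra in the span of two functions -/

/-- The functions `g` and `f` are linearly independent. -/
def IndepPair {S : Type*} (g f : S → ℂ) : Prop :=
  ∀ a b : ℂ, (∀ x, a * g x + b * f x = 0) → a = 0 ∧ b = 0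

/-- The function `k` is a linear combination of `g` and `f`. -/
def InSpan {S : Type*} (g f k : S → ℂ) : Prop :=
  ∃ a b : ℂ, ∀ x, k x = a * g x + b * f x

namespace IndepPair

variable {S : Type*} {g f : S → ℂ}

/-- If every 2×2 minor vanished, (f s, -g s) would be a linear relation for each s. -/
theorem exists_det_ne_zero (h : IndepPair g f) :
    ∃ s t, g s * f t - g t * f s ≠ 0 := by
  by_contra! H
  have hg : ∀ s, g s = 0 := by
    intro s
    have := (h (f s) (-g s) fun x => by linear_combination H x s).2
    simpa using this
  have := (h 1 0 fun x => by simp [hg]).1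
  exact one_ne_zero this

theorem coeff_eq (h : IndepPair g f) {a b c d : ℂ}
    (H : ∀ x, a * g x + b * f x = c * g x + d * f x) : a = c ∧ b = d := by
  have := h (a - c) (b - d) fun x => by linear_combination H x
  exact ⟨sub_eq_zero.1 this.1, sub_eq_zero.1 this.2⟩

/-- Comparison of the coefficients of two bilinear expressions. -/
theorem bilin_coeff_eq (h : IndepPair g f) {a b c d a' b' c' d' : ℂ}
    (H : ∀ x y, a * (g x * g y) + b * (g x * f y) + c * (f x * g y) + d * (f x * f y) =
      a' * (g x * g y) + b' * (g x * f y) + c' * (f x * g y) + d' * (f x * f y)) :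
    a = a' ∧ b = b' ∧ c = c' ∧ d = d' := by
  have key : ∀ y, a * g y + b * f y = a' * g y + b' * f y ∧
      c * g y + d * f y = c' * g y + d' * f y := fun y =>
    h.coeff_eq fun x => by linear_combination H x y
  obtain ⟨h1, h2⟩ := h.coeff_eq fun y => (key y).1
  obtain ⟨h3, h4⟩ := h.coeff_eq fun y => (key y).2
  exact ⟨h1, h2, h3, h4⟩

/-- A function of two variables lying in the span of `g, f` in each variable is bilinear in
`g, f`. -/
theorem exists_bilin (h : IndepPair g f) {k : S → S → ℂ}
    (h₁ : ∀ y, InSpan g f fun x => k x y) (h₂ : ∀ x, InSpan g f (k x)) :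
    ∃ a b c d : ℂ, ∀ x y,
      k x y = a * (g x * g y) + b * (g x * f y) + c * (f x * g y) + d * (f x * f y) := by
  obtain ⟨s, t, hD⟩ := h.exists_det_ne_zero
  obtain ⟨a, b, hs⟩ := h₂ s
  obtain ⟨c, d, ht⟩ := h₂ t
  set D := g s * f t - g t * f s
  refine ⟨(a * f t - c * f s) / D, (b * f t - d * f s) / D, (c * g s - a * g t) / D,
    (d * g s - b * g t) / D, fun x y => ?_⟩
  obtain ⟨u, w, hk⟩ := h₁ y
  have e1 : u * g s + w * f s = a * g y + b * f y := by rw [← hs, ← hk]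
  have e2 : u * g t + w * f t = c * g y + d * f y := by rw [← ht, ← hk]
  have hu : u * D = (a * g y + b * f y) * f t - (c * g y + d * f y) * f s := by
    linear_combination f t * e1 - f s * e2
  have hw : w * D = (c * g y + d * f y) * g s - (a * g y + b * f y) * g t := by
    linear_combination g s * e2 - g t * e1
  beta_reduce at hk
  rw [hk]
  field_simp
  linear_combination g x * hu + f x * hw

theorem left_ne_zero (h : IndepPair g f) : g ≠ 0 := fun h0 =>
  one_ne_zero (h 1 0 fun x => by simp [h0]).1

theorem right_ne_zero (h : IndepPair g f) : f ≠ 0 := fun h0 =>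
  one_ne_zero (h 0 1 fun x => by simp [h0]).2

/-- Coordinates of an independent pair in another one have non-zero determinant. -/
theorem det_ne_zero {p q : S → ℂ} (hi : IndepPair g f) {a b c d : ℂ}
    (hf : ∀ x, f x = a * p x + b * q x) (hg : ∀ x, g x = c * p x + d * q x) :
    a * d - b * c ≠ 0 := by
  intro H
  have h1 := hi (-b) d fun x => by rw [hf, hg]; linear_combination p x * H
  have h2 := hi (-a) c fun x => by rw [hf, hg]; linear_combination -q x * H
  obtain ⟨hb, hd⟩ := h1
  obtain ⟨ha, hc⟩ := h2
  exact hi.left_ne_zero (funext fun x => by rw [hg, hc, hd]; simp)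

end IndepPair

namespace InSpan

variable {S : Type*} {g f k l : S → ℂ}

theorem lin (hk : InSpan g f k) (hl : InSpan g f l) (a b : ℂ) :
    InSpan g f fun x => a * k x + b * l x := by
  obtain ⟨c, d, hk⟩ := hk
  obtain ⟨c', d', hl⟩ := hl
  exact ⟨a * c + b * c', a * d + b * d', fun x => by simp only [hk, hl]; ring⟩

/-- Both components of a pair lie in a span as soon as two independent combinations do. -/
theorem solve {a b c d : ℂ} (hD : a * d - c * b ≠ 0)
    (h₁ : InSpan g f fun x => a * k x - b * l x)
    (h₂ : InSpan g f fun x => c * k x - d * l x) : InSpan g f k ∧ InSpan g f l := by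
  obtain ⟨D, hDe⟩ : ∃ D, D = a * d - c * b := ⟨_, rfl⟩
  rw [← hDe] at hD
  constructor
  · convert h₁.lin h₂ (d / D) (-b / D) using 2 with x
    field_simp; rw [hDe]; ring
  · convert h₁.lin h₂ (c / D) (-a / D) using 2 with x
    field_simp; rw [hDe]; ring

end InSpan

/-- A function multiplicative on the semigroup, bundled. -/
def mulHomOf {S : Type*} [Semigroup S] (k : S → ℂ) (h : ∀ x y, k (x * y) = k x * k y) :
    S →ₙ* ℂ := ⟨k, h⟩

/-! ### Symmetries of g - αf and stability of the span -/

section Forward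

variable {S : Type*} [Semigroup S] {σ : S ≃* S} {α : ℂ} {g f : S → ℂ}

theorem IsSolution.diff_mul (hσ : Function.Involutive σ) (h : IsSolution σ α g f) (x y : S) :
    g (x * y) - α * f (x * y) = g x * g (σ y) - f x * f (σ y) := by
  have := h x (σ y)
  rw [hσ y] at this
  linear_combination this

theorem IsSolution.diff_swap (hσ : Function.Involutive σ) (h : IsSolution σ α g f) (x y : S) :
    g (x * y) - α * f (x * y) = g (σ y * σ x) - α * f (σ y * σ x) := by
  rw [h.diff_mul hσ, h.diff_mul hσ, hσ x]; ring

/-- `g - αf` is invariant under cyclic permutations of triple products. -/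
theorem IsSolution.diff_cyclic (hσ : Function.Involutive σ) (h : IsSolution σ α g f)
    (x y z : S) :
    g (x * y * z) - α * f (x * y * z) = g (y * z * x) - α * f (y * z * x) := by
  rw [h.diff_swap hσ (x * y) z, map_mul, ← mul_assoc, h.diff_swap hσ (σ z * σ x) (σ y)]
  simp only [map_mul, hσ _, mul_assoc]

/-- The span of an independent solution pair is invariant under left and right translations. -/
theorem IsSolution.translates (hσ : Function.Involutive σ) (h : IsSolution σ α g f)
    (hi : IndepPair g f) :
    (∀ y, InSpan g f (fun x => g (x * y)) ∧ InSpan g f (fun x => f (x * y))) ∧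
    (∀ x, InSpan g f (fun y => g (x * y)) ∧ InSpan g f (fun y => f (x * y))) := by
  obtain ⟨s, t, hD⟩ := hi.exists_det_ne_zero
  have e : ∀ x y s, g s * g (x * y) - f s * f (x * y) =
      g (x * y * σ s) - α * f (x * y * σ s) := fun x y s => by
    rw [h.diff_mul hσ, hσ s]; ring
  have hD' : g s * f t - g t * f s ≠ 0 := hD
  constructor
  · intro y
    have k : ∀ s, InSpan g f fun x => g s * g (x * y) - f s * f (x * y) := fun s =>
      ⟨g (σ (y * σ s)), -f (σ (y * σ s)), fun x => by
        simp only [e]; rw [mul_assoc, h.diff_mul hσ]; ring⟩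
    exact InSpan.solve hD' (k s) (k t)
  · intro x
    -- Rotating x y σ(s) to y σ(s) x brings the free variable y to the front, where the product
    -- formula applies.
    have k : ∀ s, InSpan g f fun y => g s * g (x * y) - f s * f (x * y) := fun s =>
      ⟨g (σ (σ s * x)), -f (σ (σ s * x)), fun y => by
        simp only [e]; rw [h.diff_cyclic hσ, mul_assoc, h.diff_mul hσ]; ring⟩
    exact InSpan.solve hD' (k s) (k t)

/-- The combination g(s)·g∘σ - f(s)·f∘σ is the translate x ↦ F(sx) of F = g - αf, hence in the span;
two points s with non-zero minor separate g∘σ from f∘σ. -/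
theorem IsSolution.comp_mem (hσ : Function.Involutive σ) (h : IsSolution σ α g f)
    (hi : IndepPair g f) :
    InSpan g f (fun x => g (σ x)) ∧ InSpan g f (fun x => f (σ x)) := by
  obtain ⟨s, t, hD⟩ := hi.exists_det_ne_zero
  have ht := (h.translates hσ hi).2
  have k : ∀ s, InSpan g f fun x => g s * g (σ x) - f s * f (σ x) := fun s => by
    convert (ht s).1.lin (ht s).2 1 (-α) using 2 with x
    linear_combination -h.diff_mul hσ s x
  exact InSpan.solve hD (k s) (k t)

/-! ### The dual algebra: unit and normal form -/

/-- Some non-zero functional on the span of an independent solution pair, supported at two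
points, acts as a two-sided unit. -/
theorem IsSolution.exists_unit (hσ : Function.Involutive σ) (h : IsSolution σ α g f)
    (hi : IndepPair g f) :
    ∃ (s₁ s₂ : S) (t₁ t₂ : ℂ),
      ¬ (t₁ * g s₁ + t₂ * g s₂ = 0 ∧ t₁ * f s₁ + t₂ * f s₂ = 0) ∧
      (∀ y, t₁ * g (s₁ * y) + t₂ * g (s₂ * y) = g y) ∧
      (∀ y, t₁ * f (s₁ * y) + t₂ * f (s₂ * y) = f y) ∧
      (∀ y, t₁ * g (y * s₁) + t₂ * g (y * s₂) = g y) ∧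
      (∀ y, t₁ * f (y * s₁) + t₂ * f (y * s₂) = f y) := by
  obtain ⟨s, t, hD⟩ := hi.exists_det_ne_zero
  obtain ⟨hg, hf⟩ := h.comp_mem hσ hi
  obtain ⟨a, b, hab⟩ := hg.lin hf 1 (-α)
  have hF : ∀ x, g x - α * f x = a * g (σ x) + b * f (σ x) := fun x => by
    have := hab (σ x); simp only [hσ x] at this; linear_combination this
  set D := g s * f t - g t * f s with hDdef
  -- The functional E(k) = t₁k(s) + t₂k(t) is fixed by E(g) = a, E(f) = -b, so that E applied to x ↦
  -- F(xy) gives a g(σy) + b f(σy) = F(y).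
  obtain ⟨t₁, t₂, hu, hw⟩ : ∃ t₁ t₂ : ℂ, t₁ * g s + t₂ * g t = a ∧ t₁ * f s + t₂ * f t = -b := by
    refine ⟨(a * f t + b * g t) / D, (-b * g s - a * f s) / D, ?_, ?_⟩ <;>
    · field_simp; rw [hDdef]; ring
  have hunit : ∀ y, t₁ * (g (s * y) - α * f (s * y)) + t₂ * (g (t * y) - α * f (t * y)) =
      g y - α * f y := fun y => by
    rw [h.diff_mul hσ, h.diff_mul hσ, hF]
    linear_combination g (σ y) * hu - f (σ y) * hw
  have sep : ∀ u w : ℂ, (∀ z, u * g z - w * f z = 0) → u = 0 ∧ w = 0 := fun u w H => by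
    have := hi u (-w) fun x => by linear_combination H x
    simpa using this
  have hl : ∀ y, t₁ * g (s * y) + t₂ * g (t * y) - g y = 0 ∧
      t₁ * f (s * y) + t₂ * f (t * y) - f y = 0 := fun y => by
    refine sep _ _ fun z => ?_
    have h0 := hunit (y * σ z)
    rw [← mul_assoc, ← mul_assoc, h.diff_mul hσ, h.diff_mul hσ, h.diff_mul hσ, hσ z] at h0
    linear_combination h0
  -- Cyclicity moves s and t to the right end, giving the right unit law for g∘σ and f∘σ; it passes
  -- to g and f because these are combinations of g∘σ and f∘σ.
  have hr' : ∀ y, t₁ * g (σ (y * s)) + t₂ * g (σ (y * t)) - g (σ y) = 0 ∧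
      t₁ * f (σ (y * s)) + t₂ * f (σ (y * t)) - f (σ y) = 0 := fun y => by
    refine sep _ _ fun x => ?_
    have h0 := hunit (x * y)
    rw [← mul_assoc, ← mul_assoc, h.diff_cyclic hσ s x y, h.diff_cyclic hσ t x y, mul_assoc,
      mul_assoc, h.diff_mul hσ, h.diff_mul hσ, h.diff_mul hσ] at h0
    linear_combination h0
  obtain ⟨c, d, hg⟩ := hg
  obtain ⟨c', d', hf⟩ := hf
  have hg' : ∀ x, g x = c * g (σ x) + d * f (σ x) := fun x => by
    have := hg (σ x); simpa only [hσ x] using this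
  have hf' : ∀ x, f x = c' * g (σ x) + d' * f (σ x) := fun x => by
    have := hf (σ x); simpa only [hσ x] using this
  refine ⟨s, t, t₁, t₂, ?_, fun y => sub_eq_zero.1 (hl y).1, fun y => sub_eq_zero.1 (hl y).2,
    fun y => ?_, fun y => ?_⟩
  · rintro ⟨h1, h2⟩
    have ha : a = 0 := by rw [← hu, h1]
    have hb : b = 0 := by rw [← neg_eq_zero, ← hw, h2]
    have := (hi 1 (-α) fun x => by linear_combination hF x + ha * g (σ x) + hb * f (σ x)).1
    exact one_ne_zero this
  · rw [hg' (y * s), hg' (y * t), hg' y]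
    linear_combination c * (hr' y).1 + d * (hr' y).2
  · rw [hf' (y * s), hf' (y * t), hf' y]
    linear_combination c' * (hr' y).1 + d' * (hr' y).2

/-- The span of an independent solution pair has a basis `p, q` multiplying like
`p + q√δ`. -/
theorem IsSolution.exists_basis (hσ : Function.Involutive σ) (h : IsSolution σ α g f)
    (hi : IndepPair g f) :
    ∃ (p q : S → ℂ) (δ : ℂ), IndepPair p q ∧ InSpan p q g ∧ InSpan p q f ∧
      InSpan g f p ∧ InSpan g f q ∧
      (∀ x y, p (x * y) = p x * p y + δ * (q x * q y)) ∧
      (∀ x y, q (x * y) = p x * q y + q x * p y) := by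
  obtain ⟨s₁, s₂, t₁, t₂, hne, hlg, hlf, hrg, hrf⟩ := h.exists_unit hσ hi
  obtain ⟨hr, hl⟩ := h.translates hσ hi
  set e₁ := t₁ * g s₁ + t₂ * g s₂ with he₁
  set e₂ := t₁ * f s₁ + t₂ * f s₂ with he₂
  obtain ⟨u, w, huw⟩ : ∃ u w : ℂ, u * e₁ + w * e₂ = 1 := by
    by_cases h1 : e₁ = 0
    · have h2 : e₂ ≠ 0 := fun h2 => hne ⟨h1, h2⟩
      exact ⟨0, e₂⁻¹, by simp [h2]⟩
    · exact ⟨e₁⁻¹, 0, by simp [h1]⟩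
  obtain ⟨a₁, b₁, c₁, d₁, hgm⟩ := hi.exists_bilin (k := fun x y => g (x * y))
    (fun y => (hr y).1) (fun x => (hl x).1)
  obtain ⟨a₂, b₂, c₂, d₂, hfm⟩ := hi.exists_bilin (k := fun x y => f (x * y))
    (fun y => (hr y).2) (fun x => (hl x).2)
  have lg := hi.coeff_eq (a := a₁ * e₁ + c₁ * e₂) (b := b₁ * e₁ + d₁ * e₂) (c := 1) (d := 0)
    fun y => by
      linear_combination hlg y - t₁ * hgm s₁ y - t₂ * hgm s₂ y
  have lf := hi.coeff_eq (a := a₂ * e₁ + c₂ * e₂) (b := b₂ * e₁ + d₂ * e₂) (c := 0) (d := 1)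
    fun y => by
      linear_combination hlf y - t₁ * hfm s₁ y - t₂ * hfm s₂ y
  have rg := hi.coeff_eq (a := a₁ * e₁ + b₁ * e₂) (b := c₁ * e₁ + d₁ * e₂) (c := 1) (d := 0)
    fun y => by
      linear_combination hrg y - t₁ * hgm y s₁ - t₂ * hgm y s₂
  have rf := hi.coeff_eq (a := a₂ * e₁ + b₂ * e₂) (b := c₂ * e₁ + d₂ * e₂) (c := 0) (d := 1)
    fun y => by
      linear_combination hrf y - t₁ * hfm y s₁ - t₂ * hfm y s₂
  clear_value e₁ e₂
  obtain ⟨lg1, lg2⟩ := lg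
  obtain ⟨lf1, lf2⟩ := lf
  obtain ⟨rg1, rg2⟩ := rg
  obtain ⟨rf1, rf2⟩ := rf
  -- At the unit (e₁, e₂), P takes the value 1 and q the value 0, so the unit laws fix every
  -- coefficient of P(xy) and q(xy) except those of q(x)q(y).
  let P : S → ℂ := fun x => u * g x + w * f x
  let q : S → ℂ := fun x => e₂ * g x - e₁ * f x
  have hgP : ∀ x, g x = e₁ * P x + w * q x := fun x => by
    simp only [P, q]; linear_combination -g x * huw
  have hfP : ∀ x, f x = e₂ * P x - u * q x := fun x => by
    simp only [P, q]; linear_combination -f x * huw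
  -- the coefficients of `q x * q y` in `P (x * y)` and `q (x * y)`
  let A : ℂ := a₁ * w * w - b₁ * w * u - c₁ * u * w + d₁ * u * u
  let B : ℂ := a₂ * w * w - b₂ * w * u - c₂ * u * w + d₂ * u * u
  have gmul : ∀ x y, g (x * y) = e₁ * (P x * P y) + w * (P x * q y + q x * P y) +
      A * (q x * q y) := fun x y => by
    have := hgm x y
    rw [this, hgP x, hgP y, hfP x, hfP y]
    simp only [A]
    linear_combination (P x * P y * e₁ + P x * q y * w) * lg1 +
      (P x * P y * e₂ - P x * q y * u) * lg2 + (q x * P y * w) * rg1 - (q x * P y * u) * rg2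
  have fmul : ∀ x y, f (x * y) = e₂ * (P x * P y) - u * (P x * q y + q x * P y) +
      B * (q x * q y) := fun x y => by
    have := hfm x y
    rw [this, hgP x, hgP y, hfP x, hfP y]
    simp only [B]
    linear_combination (P x * P y * e₁ + P x * q y * w) * lf1 +
      (P x * P y * e₂ - P x * q y * u) * lf2 + (q x * P y * w) * rf1 - (q x * P y * u) * rf2
  let β : ℂ := e₂ * A - e₁ * B
  let γ : ℂ := u * A + w * B
  have Pmul : ∀ x y, P (x * y) = P x * P y + γ * (q x * q y) := fun x y => by
    change u * g (x * y) + w * f (x * y) = _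
    rw [gmul, fmul]; simp only [γ]; linear_combination P x * P y * huw
  have qmul : ∀ x y, q (x * y) = P x * q y + q x * P y + β * (q x * q y) := fun x y => by
    change e₂ * g (x * y) - e₁ * f (x * y) = _
    rw [gmul, fmul]; simp only [β]; linear_combination (P x * q y + q x * P y) * huw
  -- Completing the square removes the term β q(x)q(y) from q(xy).
  refine ⟨fun x => P x + β / 2 * q x, q, γ + β ^ 2 / 4, ?_, ?_, ?_, ?_, ?_, ?_, ?_⟩
  · intro a b H
    have hab := hi (a * u + (a * (β / 2) + b) * e₂) (a * w - (a * (β / 2) + b) * e₁) fun x => by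
      have := H x
      simp only [P, q] at this
      linear_combination this
    have ha : a = 0 := by linear_combination e₁ * hab.1 + e₂ * hab.2 - a * huw
    have hb : b = 0 := by
      subst ha
      linear_combination w * hab.1 - u * hab.2 - b * huw
    exact ⟨ha, hb⟩
  · exact ⟨e₁, w - e₁ * (β / 2), fun x => by rw [hgP x]; ring⟩
  · exact ⟨e₂, -u - e₂ * (β / 2), fun x => by rw [hfP x]; ring⟩
  · exact ⟨u + β / 2 * e₂, w - β / 2 * e₁, fun x => by simp only [P, q]; ring⟩
  · exact ⟨e₂, -e₁, fun x => by simp only [q]; ring⟩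
  · intro x y
    simp only [Pmul, qmul]; ring
  · intro x y
    simp only [qmul]; ring

/-- The span of an independent solution pair is spanned by two multiplicative functions, or by
a multiplicative function and a solution of the corresponding special sine addition law. -/
theorem IsSolution.exists_exponential_basis (hσ : Function.Involutive σ)
    (h : IsSolution σ α g f) (hi : IndepPair g f) :
    (∃ χ₁ χ₂ : S →ₙ* ℂ, IndepPair χ₁ χ₂ ∧ InSpan χ₁ χ₂ g ∧ InSpan χ₁ χ₂ f ∧
      InSpan g f χ₁ ∧ InSpan g f χ₂) ∨
    (∃ (χ : S →ₙ* ℂ) (k : S → ℂ), SineLaw χ k ∧ IndepPair χ k ∧ InSpan χ k g ∧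
      InSpan χ k f ∧ InSpan g f χ ∧ InSpan g f k) := by
  obtain ⟨p, q, δ, hpq, hg, hf, hp, hq, pm, qm⟩ := h.exists_basis hσ hi
  obtain ⟨d, rfl⟩ := IsAlgClosed.exists_pow_nat_eq δ (n := 2) two_pos
  -- For d ≠ 0 the functions p ± dq are multiplicative; for d = 0 p is multiplicative and q obeys
  -- its sine law.
  by_cases hd : d = 0
  · subst hd
    right
    exact ⟨mulHomOf p fun x y => by rw [pm]; ring, q,
      fun x y => by rw [qm]; change _ = q x * p y + q y * p x; ring, hpq, hg, hf, hp, hq⟩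
  · left
    obtain ⟨a, b, hg⟩ := hg
    obtain ⟨c, e, hf⟩ := hf
    have hp' := hp.lin hq 1 d
    have hp'' := hp.lin hq 1 (-d)
    refine ⟨mulHomOf (fun x => 1 * p x + d * q x) fun x y => by simp only [pm, qm]; ring,
      mulHomOf (fun x => 1 * p x + -d * q x) fun x y => by simp only [pm, qm]; ring,
      ?_, ?_, ?_, hp', hp''⟩
    · intro s t H
      obtain ⟨h1, h2⟩ := hpq (s + t) (d * (s - t)) fun x => by
        have : s * (1 * p x + d * q x) + t * (1 * p x + -d * q x) = 0 := H x
        linear_combination this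
      have h3 := (mul_eq_zero.1 h2).resolve_left hd
      constructor
      · linear_combination (h1 + h3) / 2
      · linear_combination (h1 - h3) / 2
    · refine ⟨(a + b / d) / 2, (a - b / d) / 2, fun x => ?_⟩
      change _ = _ * (1 * p x + d * q x) + _ * (1 * p x + -d * q x)
      rw [hg]; field_simp; ring
    · refine ⟨(c + e / d) / 2, (c - e / d) / 2, fun x => ?_⟩
      change _ = _ * (1 * p x + d * q x) + _ * (1 * p x + -d * q x)
      rw [hf]; field_simp; ring

/-! ### Independent solutions: action of σ and comparison of coefficients -/

/-- A span of two functions containing an independent σ-stable pair is σ-stable. -/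
theorem InSpan.comp_of_span {p q k : S → ℂ} (hgσ : InSpan g f fun x => g (σ x))
    (hfσ : InSpan g f fun x => f (σ x)) (hg : InSpan p q g) (hf : InSpan p q f)
    (hk : InSpan g f k) : InSpan p q fun x => k (σ x) := by
  obtain ⟨a, b, hk⟩ := hk
  obtain ⟨c, d, hgσ⟩ := hgσ
  obtain ⟨c', d', hfσ⟩ := hfσ
  convert hg.lin hf (a * c + b * c') (a * d + b * d') using 2 with x
  beta_reduce at hgσ hfσ
  rw [hk, hgσ, hfσ]; ring

theorem IndepPair.mulHom_ne {p q : S →ₙ* ℂ} (h : IndepPair p q) : p ≠ q := fun h0 =>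
  one_ne_zero (h 1 (-1) fun x => by simp [h0]).1

/-- A multiplicative combination of two independent multiplicative functions is one of them,
or zero. -/
theorem eq_or_eq_of_mem_span {χ₁ χ₂ : S →ₙ* ℂ} (hi : IndepPair χ₁ χ₂) {k : S → ℂ}
    (hk : ∀ x y, k (x * y) = k x * k y) (h0 : k ≠ 0) (h : InSpan χ₁ χ₂ k) :
    (∀ x, k x = χ₁ x) ∨ (∀ x, k x = χ₂ x) := by
  obtain ⟨s, t, hst⟩ := h
  obtain ⟨e1, e2, -, e4⟩ := hi.bilin_coeff_eq (a := s) (b := 0) (c := 0) (d := t)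
    (a' := s * s) (b' := s * t) (c' := t * s) (d' := t * t) fun x y => by
      have := hk x y
      rw [hst, hst x, hst y, map_mul, map_mul] at this
      linear_combination this
  rcases mul_eq_zero.1 e2.symm with rfl | rfl
  · right
    rcases eq_or_ne t 0 with rfl | ht
    · exact absurd (funext fun x => by simp [hst]) h0
    · have : t = 1 := mul_left_cancel₀ ht (by linear_combination -e4)
      intro x; rw [hst, this]; ring
  · left
    rcases eq_or_ne s 0 with rfl | hs
    · exact absurd (funext fun x => by simp [hst]) h0
    · have : s = 1 := mul_left_cancel₀ hs (by linear_combination -e1)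
      intro x; rw [hst, this]; ring

theorem IsSolution.family_of_even (h : IsSolution σ α g f) (hi : IndepPair g f)
    {χ₁ χ₂ : S →ₙ* ℂ} (hχ : IndepPair χ₁ χ₂) (h₁ : IsEven σ χ₁) (h₂ : IsEven σ χ₂)
    (hg : InSpan χ₁ χ₂ g) (hf : InSpan χ₁ χ₂ f) : Family5 σ α g f ∨ Family6 σ α g f := by
  obtain ⟨c, d, hg⟩ := hg
  obtain ⟨a, b, hf⟩ := hf
  have hD := hi.det_ne_zero hf hg
  obtain ⟨e1, e2, -, e4⟩ := hχ.bilin_coeff_eq (a := c - α * a) (b := 0) (c := 0)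
    (d := d - α * b) (a' := c * c - a * a) (b' := c * d - a * b) (c' := d * c - b * a)
    (d' := d * d - b * b) fun x y => by
      have := h x y
      simp only [hg, hf, map_mul, h₁ y, h₂ y] at this
      linear_combination this
  -- With u = c + d - 1 and v = a + b - α, the sum and difference of the coefficient equations read
  -- (c + d)u = (a + b)v and (c - d)u = (a - b)v. This homogeneous system has determinant ±2(ad -
  -- bc) ≠ 0.
  have ht : c + d = 1 := by
    have : (a * d - b * c) * (c + d - 1) = 0 := by
      linear_combination ((a + b) * (e1 - e4) - (a - b) * (e1 + e4 + 2 * e2)) / 2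
    exact sub_eq_zero.1 ((mul_eq_zero.1 this).resolve_left hD)
  have hs : a + b = α := by
    have : (a * d - b * c) * (a + b - α) = 0 := by
      linear_combination ((c + d) * (e1 - e4) - (c - d) * (e1 + e4 + 2 * e2)) / 2
    exact sub_eq_zero.1 ((mul_eq_zero.1 this).resolve_left hD)
  by_cases hb : b = 0
  · subst hb
    have hc : c = 0 := by
      have : c * d = 0 := by linear_combination -e2
      rcases mul_eq_zero.1 this with hc | hd
      · exact hc
      · exact absurd (by rw [hd]; ring) hD
    right
    refine ⟨?_, χ₁, χ₂, hχ.mulHom_ne, hχ.left_ne_zero, hχ.right_ne_zero, h₁, h₂, fun x => ?_,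
      fun x => ?_⟩
    · rintro rfl
      exact hD (by linear_combination d * hs)
    · rw [hf]; linear_combination χ₁ x * hs
    · rw [hg]; linear_combination χ₂ x * ht + hc * (χ₁ x - χ₂ x)
  by_cases ha : a = 0
  · subst ha
    have hd : d = 0 := by
      have : d * c = 0 := by linear_combination -e2
      rcases mul_eq_zero.1 this with hd | hc
      · exact hd
      · exact absurd (by rw [hc]; ring) hD
    right
    refine ⟨?_, χ₂, χ₁, hχ.mulHom_ne.symm, hχ.right_ne_zero, hχ.left_ne_zero, h₂, h₁,
      fun x => ?_, fun x => ?_⟩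
    · rintro rfl
      exact hD (by linear_combination -c * hs)
    · rw [hf]; linear_combination χ₂ x * hs
    · rw [hg]; linear_combination χ₁ x * ht + hd * (χ₂ x - χ₁ x)
  left
  -- Since cd = ab, (c - d)² = 1 - 4ab = 1 + (a - b)² - α². The conditions q ≠ ±α amount to b ≠ 0
  -- and a ≠ 0.
  refine ⟨a - b, c - d, χ₁, χ₂, ?_, ?_, ?_, hχ.mulHom_ne, hχ.left_ne_zero, hχ.right_ne_zero,
    h₁, h₂, fun x => ?_, fun x => ?_⟩
  · linear_combination (c + d + 1) * ht - (a + b + α) * hs + 4 * e2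
  · intro H; exact hb (by linear_combination (hs - H) / 2)
  · intro H; exact ha (by linear_combination (hs + H) / 2)
  · rw [hf]; linear_combination (χ₁ x + χ₂ x) / 2 * hs
  · rw [hg]; linear_combination (χ₁ x + χ₂ x) / 2 * ht

theorem IsSolution.family_of_swap (hσ : Function.Involutive σ) (h : IsSolution σ α g f)
    (hi : IndepPair g f)
    {χ₁ χ₂ : S →ₙ* ℂ} (hχ : IndepPair χ₁ χ₂) (h₁ : ∀ x, χ₁ (σ x) = χ₂ x)
    (hg : InSpan χ₁ χ₂ g) (hf : InSpan χ₁ χ₂ f) : Family8 σ α g f := by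
  have h₂ : ∀ x, χ₂ (σ x) = χ₁ x := fun x => by rw [← h₁, hσ x]
  obtain ⟨c, d, hg⟩ := hg
  obtain ⟨a, b, hf⟩ := hf
  have hD := hi.det_ne_zero hf hg
  obtain ⟨e1, e2, e3, e4⟩ := hχ.bilin_coeff_eq (a := 0) (b := c - α * a) (c := d - α * b)
    (d := 0) (a' := c * c - a * a) (b' := c * d - a * b) (c' := d * c - b * a)
    (d' := d * d - b * b) fun x y => by
      have := h x y
      simp only [hg, hf, map_mul, h₁ y, h₂ y] at this
      linear_combination this
  have hne : (χ₁ : S → ℂ) ≠ χ₁ ∘ σ := fun H =>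
    hχ.mulHom_ne (DFunLike.ext _ _ fun x => by rw [← h₁]; exact congrFun H x)
  have hne' : (χ₂ : S → ℂ) ≠ χ₂ ∘ σ := fun H =>
    hχ.mulHom_ne (DFunLike.ext _ _ fun x => by rw [← h₂]; exact (congrFun H x).symm)
  have f1 : (c - a) * (c + a) = 0 := by linear_combination -e1
  have f4 : (d - b) * (d + b) = 0 := by linear_combination -e4
  have ha : a ≠ 0 := by
    rintro rfl
    have hc : c = 0 := by
      have : c * c = 0 := by linear_combination f1
      exact mul_self_eq_zero.1 this
    exact hD (by rw [hc]; ring)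
  have hb : b ≠ 0 := by
    rintro rfl
    have hd : d = 0 := by
      have : d * d = 0 := by linear_combination f4
      exact mul_self_eq_zero.1 this
    exact hD (by rw [hd]; ring)
  -- Equal signs in c = ±a, d = ±b would make ad - bc vanish; the two mixed choices differ by
  -- exchanging χ₁ and χ₂.
  rcases mul_eq_zero.1 f1 with hc | hc <;> rcases mul_eq_zero.1 f4 with hd | hd
  · exact absurd (by linear_combination a * hd - b * hc) hD
  · have vb : b = (α - 1) / 2 := mul_left_cancel₀ ha (by
      linear_combination (e2 - hc + c * hd - b * hc) / 2)
    have va : a = (1 + α) / 2 := mul_left_cancel₀ hb (by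
      linear_combination (e3 - hd + c * hd - b * hc) / 2)
    refine ⟨?_, ?_, χ₁, hne, fun x => ?_, fun x => ?_⟩
    · rintro rfl; exact hb (by rw [vb]; ring)
    · rintro rfl; exact ha (by rw [va]; ring)
    · rw [hf, h₁]; linear_combination χ₁ x * va + χ₂ x * vb
    · rw [hg, h₁]; linear_combination χ₁ x * (va + hc) + χ₂ x * (hd - vb)
  · have vb : b = (α + 1) / 2 := mul_left_cancel₀ ha (by
      linear_combination (e2 - hc - a * hd + d * hc) / 2)
    have va : a = (α - 1) / 2 := mul_left_cancel₀ hb (by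
      linear_combination (e3 - hd - a * hd + d * hc) / 2)
    refine ⟨?_, ?_, χ₂, hne', fun x => ?_, fun x => ?_⟩
    · rintro rfl; exact ha (by rw [va]; ring)
    · rintro rfl; exact hb (by rw [vb]; ring)
    · rw [hf, h₂]; linear_combination χ₁ x * va + χ₂ x * vb
    · rw [hg, h₂]; linear_combination χ₁ x * (hc - va) + χ₂ x * (hd + vb)
  · exact absurd (by linear_combination a * hd - b * hc) hD

theorem IsSolution.family_of_sine (hσ : Function.Involutive σ) (h : IsSolution σ α g f)
    (hi : IndepPair g f) {χ : S →ₙ* ℂ} {k : S → ℂ} (hk : SineLaw χ k) (hχ : IndepPair χ k)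
    (hχσ : InSpan χ k fun x => χ (σ x)) (hkσ : InSpan χ k fun x => k (σ x))
    (hg : InSpan χ k g) (hf : InSpan χ k f) : Family7 σ α g f := by
  have hχe : IsEven σ χ := by
    obtain ⟨s, t, hst⟩ := hχσ
    beta_reduce at hst
    obtain ⟨e1, -, -, e4⟩ := hχ.bilin_coeff_eq (a := s) (b := t) (c := t) (d := 0)
      (a' := s * s) (b' := s * t) (c' := t * s) (d' := t * t) fun x y => by
        have := hst (x * y)
        rw [map_mul, map_mul, hst, hst, hk, map_mul] at this
        linear_combination -this
    -- Multiplicativity of χ∘σ would produce a term t²k(x)k(y), which the product rules of χ and k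
    -- never yield.
    have ht : t = 0 := mul_self_eq_zero.1 e4.symm
    subst ht
    have hs : s ≠ 0 := by
      rintro rfl
      refine hχ.left_ne_zero (funext fun x => ?_)
      have := hst (σ x)
      simpa [hσ x] using this
    have : s = 1 := mul_left_cancel₀ hs (by linear_combination -e1)
    intro x; rw [hst, this]; ring
  obtain ⟨ε, hε, hkε⟩ : ∃ ε : ℂ, (ε = 1 ∨ ε = -1) ∧ ∀ x, k (σ x) = ε * k x := by
    obtain ⟨s, t, hst⟩ := hkσ
    beta_reduce at hst
    obtain ⟨e1, -, -, -⟩ := hχ.bilin_coeff_eq (a := s) (b := t) (c := t) (d := 0)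
      (a' := 2 * s) (b' := t) (c' := t) (d' := 0) fun x y => by
        have := hst (x * y)
        rw [map_mul, hk, hst, hst, hk, map_mul, hχe, hχe] at this
        linear_combination -this
    have hs : s = 0 := by linear_combination -e1
    subst hs
    have hst' : ∀ x, k (σ x) = t * k x := fun x => by rw [hst]; ring
    refine ⟨t, ?_, hst'⟩
    have := (hχ 0 (t * t - 1) fun x => by
      have := hst' (σ x)
      rw [hσ x, hst'] at this
      linear_combination -this).2
    exact mul_self_eq_one_iff.1 (by linear_combination this)
  obtain ⟨c, d, hg⟩ := hg
  obtain ⟨a, b, hf⟩ := hf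
  have hD := hi.det_ne_zero hf hg
  obtain ⟨e1, e2, e3, e4⟩ := hχ.bilin_coeff_eq (a := c - α * a) (b := ε * (d - α * b))
    (c := d - α * b)
    (d := 0) (a' := c * c - a * a) (b' := c * d - a * b) (c' := d * c - b * a)
    (d' := d * d - b * b) fun x y => by
      have := h x y
      simp only [hg, hf, map_mul, hk _ _, hχe y, hkε y] at this
      linear_combination this
  have f4 : (d - b) * (d + b) = 0 := by linear_combination -e4
  obtain ⟨η, hη, hd⟩ : ∃ η : ℂ, (η = 1 ∨ η = -1) ∧ d = η * b := by
    rcases mul_eq_zero.1 f4 with hd | hd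
    · exact ⟨1, Or.inl rfl, by linear_combination hd⟩
    · exact ⟨-1, Or.inr rfl, by linear_combination hd⟩
  have hη2 : η * η = 1 := by rcases hη with rfl | rfl <;> norm_num
  have hb : b ≠ 0 := by
    rintro rfl
    exact hD (by rw [hd]; ring)
  subst hd
  rcases hε with rfl | rfl
  · have r1 : η * c - a = η - α := mul_left_cancel₀ hb (by linear_combination -e3)
    have hac : a = α * c := by
      linear_combination -η * e1 - η * (η * c + a) * r1 + (η * (c ^ 2 - c) - (a - α * c)) * hη2
    have hc : c = 1 := by
      have h0 : (η - α) * (c - 1) = 0 := by linear_combination r1 + hac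
      rcases mul_eq_zero.1 h0 with h1 | h1
      · exact absurd (by linear_combination b * (η * hac - η * c * h1 + c * hη2)) hD
      · exact sub_eq_zero.1 h1
    subst hc
    refine ⟨χ, fun x => b * k x, hχ.left_ne_zero, hχe, fun x => ?_, fun x y => ?_, fun x => ?_, ?_⟩
    · simp only [hkε]; ring
    · simp only [hk x y]; ring
    · rw [hf, hac]; ring
    · rcases hη with rfl | rfl
      · left; intro x; rw [hg]; ring
      · right; intro x; rw [hg]; ring
  -- An odd k is impossible: it forces α = η, then a = ηc, and g, f become proportional.
  · have h1 : b * (η - α) = 0 := by linear_combination (e3 - e2) / 2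
    exact absurd (by linear_combination -η * h1 + η * e3 + b * c * hη2) hD

/-- Solutions consisting of two linearly independent functions. -/
theorem IsSolution.nonExceptional_of_indep (hσ : Function.Involutive σ)
    (h : IsSolution σ α g f) (hi : IndepPair g f) : NonExceptional σ α g f := by
  obtain ⟨hgσ, hfσ⟩ := h.comp_mem hσ hi
  rcases h.exists_exponential_basis hσ hi with
    ⟨χ₁, χ₂, hχ, hg, hf, h₁, h₂⟩ | ⟨χ, k, hk, hχ, hg, hf, h₁, h₂⟩
  · have ne : ∀ {χ : S →ₙ* ℂ}, (χ : S → ℂ) ≠ 0 → (fun x => χ (σ x)) ≠ 0 := fun h0 h1 =>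
      h0 (funext fun x => by simpa [hσ x] using congrFun h1 (σ x))
    rcases eq_or_eq_of_mem_span hχ (fun x y => by simp) (ne hχ.left_ne_zero)
      (InSpan.comp_of_span hgσ hfσ hg hf h₁) with e₁ | e₁
    · have e₂ : IsEven σ χ₂ := by
        rcases eq_or_eq_of_mem_span hχ (fun x y => by simp) (ne hχ.right_ne_zero)
          (InSpan.comp_of_span hgσ hfσ hg hf h₂) with e₂ | e₂
        · exact absurd (DFunLike.ext _ _ fun x => by rw [← e₁, ← e₂, hσ x]) hχ.mulHom_ne
        · exact e₂
      rcases h.family_of_even hi hχ e₁ e₂ hg hf with H | H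
      · exact Or.inr (Or.inr (Or.inr (Or.inl H)))
      · exact Or.inr (Or.inr (Or.inr (Or.inr (Or.inl H))))
    · exact Or.inr (Or.inr (Or.inr (Or.inr (Or.inr (Or.inr
        (h.family_of_swap hσ hi hχ e₁ hg hf))))))
  · exact Or.inr (Or.inr (Or.inr (Or.inr (Or.inr (Or.inl
      (h.family_of_sine hσ hi hk hχ (InSpan.comp_of_span hgσ hfσ hg hf h₁)
        (InSpan.comp_of_span hgσ hfσ hg hf h₂) hg hf))))))

/-! ### Dependent solutions -/

/-- Solutions whose components are multiples of a single function. -/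
theorem IsSolution.family_of_smul [Nonempty S] {k : S → ℂ} {a b : ℂ}
    (h : IsSolution σ α g f) (hf : ∀ x, f x = a * k x) (hg : ∀ x, g x = b * k x) :
    Family1 α g f ∨ NonExceptional σ α g f := by
  by_cases h0 : g = 0 ∧ f = 0
  · obtain ⟨rfl, rfl⟩ := h0
    obtain ⟨s⟩ := ‹Nonempty S›
    -- The zero pair belongs to family 4, with q = -α, r = -1 and χ = 1.
    refine Or.inr (Or.inr (Or.inr (Or.inl ⟨-α, -1, 1, by ring, fun h1 => ?_, fun x => rfl, ?_, ?_⟩)))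
    · exact one_ne_zero (congrFun h1 s)
    · simp
    · simp
  have hab : ¬ (a = 0 ∧ b = 0) := fun ⟨ha, hb⟩ =>
    h0 ⟨funext fun x => by simp [hg, hb], funext fun x => by simp [hf, ha]⟩
  have hk : ∃ s, k s ≠ 0 := by
    by_contra! H
    exact h0 ⟨funext fun x => by simp [hg, H], funext fun x => by simp [hf, H]⟩
  obtain ⟨s, hs⟩ := hk
  have key : ∀ x y, (b - α * a) * k (x * σ y) = (b ^ 2 - a ^ 2) * (k x * k y) := fun x y => by
    have := h x y
    simp only [hf, hg] at this
    linear_combination this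
  by_cases hc : b - α * a = 0
  · left
    have h1 : b ^ 2 - a ^ 2 = 0 := by
      have := key s s
      rw [hc, zero_mul] at this
      exact (mul_eq_zero.1 this.symm).resolve_right (mul_ne_zero hs hs)
    have ha : a ≠ 0 := fun ha => hab ⟨ha, by simpa [ha] using hc⟩
    have hα : (α - 1) * (α + 1) = 0 := mul_left_cancel₀ (pow_ne_zero 2 ha) (by
      linear_combination h1 - (b + α * a) * hc)
    refine ⟨?_, fun h2 => ?_, fun x => ?_⟩
    · exact (mul_eq_zero.1 hα).imp sub_eq_zero.1 eq_neg_of_add_eq_zero_left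
    · have := congrFun h2 s
      rw [hf] at this
      exact mul_ne_zero ha hs this
    · rw [hf, hg]; linear_combination k x * hc
  right
  by_cases hm : b ^ 2 - a ^ 2 = 0
  · have hk0 : ∀ x y, k (x * y) = 0 := fun x y => by
      have := key x (σ.symm y)
      rw [hm, zero_mul, σ.apply_symm_apply] at this
      exact (mul_eq_zero.1 this).resolve_left hc
    have hg0 : g ≠ 0 := fun h2 => by
      have hb : b = 0 := (mul_eq_zero.1 ((hg s).symm.trans (congrFun h2 s))).resolve_right hs
      exact hab ⟨by simpa [hb] using hm, hb⟩
    have hv : VanishesOnProducts g := fun x y => by rw [hg, hk0, mul_zero]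
    have : (b - a) * (b + a) = 0 := by linear_combination hm
    rcases mul_eq_zero.1 this with h1 | h1
    · left
      refine ⟨?_, funext fun x => ?_, hg0, hv⟩
      · rintro rfl; exact hc (by linear_combination h1)
      · rw [hf, hg]; linear_combination -k x * h1
    · right; left
      refine ⟨?_, funext fun x => ?_, hg0, hv⟩
      · rintro rfl; exact hc (by linear_combination h1)
      · simp only [hf, hg, Pi.neg_apply]; linear_combination k x * h1
  · obtain ⟨μ, hμ⟩ : ∃ μ, μ * (b - α * a) = b ^ 2 - a ^ 2 := ⟨_, div_mul_cancel₀ _ hc⟩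
    have hμ0 : μ ≠ 0 := fun h1 => hm (by rw [← hμ, h1, zero_mul])
    have key' : ∀ x y, k (x * σ y) = μ * (k x * k y) := fun x y =>
      mul_left_cancel₀ hc (by rw [key, ← hμ]; ring)
    have key2 : ∀ x y, k (x * y) = μ * (k x * k (σ.symm y)) := fun x y => by
      rw [← key', σ.apply_symm_apply]
    -- Evaluate k at s σ(s) σ(z), grouped as (s σ(s))·σ(z) and as s·σ(sz).
    have heven : ∀ z, k z = k (σ.symm z) := fun z => by
      have h1 := key' (s * σ s) z
      rw [mul_assoc, ← map_mul, key', key2, key'] at h1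
      have h2 : μ ^ 2 * k s ^ 2 * (k z - k (σ.symm z)) = 0 := by linear_combination -h1
      exact sub_eq_zero.1 ((mul_eq_zero.1 h2).resolve_left
        (mul_ne_zero (pow_ne_zero 2 hμ0) (pow_ne_zero 2 hs)))
    refine Or.inr (Or.inr (Or.inl ⟨2 * (a / μ) - α, 2 * (b / μ) - 1,
      mulHomOf (fun x => μ * k x) fun x y => ?_, ?_, fun h1 => ?_, fun x => ?_, fun x => ?_,
      fun x => ?_⟩))
    · rw [key2, ← heven]; ring
    · field_simp; linear_combination -4 * hμ
    · exact mul_ne_zero hμ0 hs (congrFun h1 s)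
    · change μ * k (σ x) = μ * k x
      rw [heven (σ x), σ.symm_apply_apply]
    · change _ = _ * (μ * k x / 2)
      rw [hf]; field_simp; ring
    · change _ = _ * (μ * k x / 2)
      rw [hg]; field_simp; ring

theorem IsSolution.family [Nonempty S] (hσ : Function.Involutive σ) (h : IsSolution σ α g f) :
    Family1 α g f ∨ NonExceptional σ α g f := by
  by_cases hi : IndepPair g f
  · exact Or.inr (h.nonExceptional_of_indep hσ hi)
  · simp only [IndepPair, not_forall] at hi
    obtain ⟨c, d, H, hcd⟩ := hi
    by_cases hc : c = 0
    · have hd : d ≠ 0 := fun hd => hcd ⟨hc, hd⟩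
      exact h.family_of_smul (k := g) (a := 0) (b := 1)
        (fun x => mul_left_cancel₀ hd (by linear_combination H x - hc * g x)) fun x => by ring
    · exact h.family_of_smul (k := f) (a := 1) (b := -d / c) (fun x => by ring)
        fun x => by field_simp; linear_combination H x

end Forward

/-! ### Converse direction and abelian property -/

section Families

variable {S : Type*} [Semigroup S] {σ : S ≃* S} {α : ℂ} {g f : S → ℂ}

theorem Family1.isSolution (h : Family1 α g f) : IsSolution σ α g f := by
  obtain ⟨hα, -, hg⟩ := h
  intro x y
  rcases hα with rfl | rfl <;> simp only [hg] <;> ring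

theorem NonExceptional.isSolution (hσ : Function.Involutive σ) (h : NonExceptional σ α g f) :
    IsSolution σ α g f := by
  intro x y
  rcases h with ⟨-, rfl, -, h⟩ | ⟨-, rfl, -, h⟩ | ⟨q, r, χ, hr, -, he, hf, hg⟩ |
    ⟨q, r, χ₁, χ₂, hr, -, -, -, -, -, h₁, h₂, hf, hg⟩ | ⟨-, χ₁, χ₂, -, -, -, h₁, h₂, hf, hg⟩ |
    ⟨χ, k, -, he, hke, hk, hf, hg⟩ | ⟨-, -, χ, -, hf, hg⟩
  · simp only [h x (σ y)]; ring
  · simp only [Pi.neg_apply, h x (σ y)]; ring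
  · simp only [hf, hg, map_mul, he y]
    linear_combination -(1 / 4) * χ x * χ y * hr
  · simp only [hf, hg, map_mul, h₁ y, h₂ y]
    linear_combination -(1 / 4) * (χ₁ x - χ₂ x) * (χ₁ y - χ₂ y) * hr
  · simp only [hf, hg, map_mul, h₁ y, h₂ y]; ring
  · rcases hg with hg | hg <;> simp only [hf, hg, map_mul, hk x (σ y), he y, hke y] <;> ring
  · simp only [hf, hg, map_mul, hσ y]; ring

theorem VanishesOnProducts.isAbelian {k : S → ℂ} (h : VanishesOnProducts k) : IsAbelian k :=
  ⟨fun x y => by rw [h, h], fun x y z => by rw [h, h]⟩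

theorem isAbelian_mulHom (χ : S →ₙ* ℂ) : IsAbelian χ :=
  ⟨fun x y => by simp only [map_mul]; ring, fun x y z => by simp only [map_mul]; ring⟩

theorem SineLaw.isAbelian {χ : S →ₙ* ℂ} {k : S → ℂ} (h : SineLaw χ k) : IsAbelian k :=
  ⟨fun x y => by rw [h, h]; ring, fun x y z => by simp only [h _ _, map_mul]; ring⟩

theorem IsAbelian.comp_mulEquiv {k : S → ℂ} (h : IsAbelian k) (σ : S ≃* S) :
    IsAbelian fun x => k (σ x) :=
  ⟨fun x y => by simp only [map_mul, h.1 (σ x)],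
    fun x y z => by simp only [map_mul, h.2 (σ x) (σ y)]⟩

theorem IsAbelian.lin {k l m : S → ℂ} (hk : IsAbelian k) (hl : IsAbelian l) (a b : ℂ)
    (h : ∀ x, m x = a * k x + b * l x) : IsAbelian m :=
  ⟨fun x y => by rw [h, h, hk.1, hl.1], fun x y z => by rw [h, h, hk.2, hl.2]⟩

theorem NonExceptional.isAbelian (h : NonExceptional σ α g f) : IsAbelian g ∧ IsAbelian f := by
  rcases h with ⟨-, rfl, -, h⟩ | ⟨-, rfl, -, h⟩ | ⟨q, r, χ, -, -, -, hf, hg⟩ |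
    ⟨q, r, χ₁, χ₂, -, -, -, -, -, -, -, -, hf, hg⟩ | ⟨-, χ₁, χ₂, -, -, -, -, -, hf, hg⟩ |
    ⟨χ, k, -, -, -, hk, hf, hg⟩ | ⟨-, -, χ, -, hf, hg⟩
  · exact ⟨h.isAbelian, h.isAbelian⟩
  · exact ⟨h.isAbelian, h.isAbelian.lin h.isAbelian (-1) 0 fun x => by simp⟩
  · have hχ := isAbelian_mulHom χ
    exact ⟨hχ.lin hχ ((1 + r) / 2) 0 fun x => by rw [hg]; ring,
      hχ.lin hχ ((q + α) / 2) 0 fun x => by rw [hf]; ring⟩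
  · exact ⟨(isAbelian_mulHom χ₁).lin (isAbelian_mulHom χ₂) ((1 + r) / 2) ((1 - r) / 2)
        fun x => by rw [hg]; ring,
      (isAbelian_mulHom χ₁).lin (isAbelian_mulHom χ₂) ((α + q) / 2) ((α - q) / 2)
        fun x => by rw [hf]; ring⟩
  · exact ⟨(isAbelian_mulHom χ₁).lin (isAbelian_mulHom χ₂) 0 1 fun x => by rw [hg]; ring,
      (isAbelian_mulHom χ₁).lin (isAbelian_mulHom χ₂) α 0 fun x => by rw [hf]; ring⟩
  · refine ⟨?_, (isAbelian_mulHom χ).lin hk.isAbelian α 1 fun x => by rw [hf]; ring⟩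
    rcases hg with hg | hg
    · exact (isAbelian_mulHom χ).lin hk.isAbelian 1 1 fun x => by rw [hg]; ring
    · exact (isAbelian_mulHom χ).lin hk.isAbelian 1 (-1) fun x => by rw [hg]; ring
  · have hχ := isAbelian_mulHom χ
    exact ⟨hχ.lin (hχ.comp_mulEquiv σ) ((1 + α) / 2) ((1 - α) / 2) hg,
      hχ.lin (hχ.comp_mulEquiv σ) ((1 + α) / 2) (-((1 - α) / 2)) fun x => by rw [hf]; ring⟩

end Families

/-! ### Continuity -/

section Continuity

variable {S : Type*} [Semigroup S] [TopologicalSpace S] [ContinuousMul S] {σ : S ≃* S} {α : ℂ}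
  {g f : S → ℂ}

/-- If a combination of two different multiplicative functions with non-zero coefficients is
continuous, then so are both functions. -/
theorem continuous_of_lin_mul {k l : S → ℂ} (hk : ∀ x y, k (x * y) = k x * k y)
    (hl : ∀ x y, l (x * y) = l x * l y) (hne : k ≠ l) {a b : ℂ} (ha : a ≠ 0) (hb : b ≠ 0)
    (hf : Continuous f) (h : ∀ x, f x = a * k x + b * l x) : Continuous k ∧ Continuous l := by
  obtain ⟨s, hs⟩ := Function.ne_iff.1 hne
  have hs' := sub_ne_zero.2 hs
  have ht : Continuous fun x => f (x * s) := hf.comp (continuous_mul_const s)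
  constructor
  -- Subtracting l(s)f(x) from f(xs) cancels the l-part and leaves a(k(s) - l(s))k(x).
  · have e : k = fun x => (f (x * s) - l s * f x) / (a * (k s - l s)) := by
      funext x; rw [h, h, hk, hl]; field_simp; ring
    rw [e]; exact (ht.sub (continuous_const.mul hf)).div_const _
  · have e : l = fun x => (k s * f x - f (x * s)) / (b * (k s - l s)) := by
      funext x; rw [h, h, hk, hl]; field_simp; ring
    rw [e]; exact ((continuous_const.mul hf).sub ht).div_const _

theorem IsSolution.continuous [Nonempty S] (hσ : Function.Involutive σ)
    (h : IsSolution σ α g f) (hf : Continuous f)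
    (hne : ∀ χ : S →ₙ* ℂ, Continuous χ → ¬ ∀ x, f x = α * χ x) : Continuous g := by
  -- The zero function is an admissible continuous χ, so f = 0 is excluded.
  have hf0 : ¬ ∀ x, f x = 0 := fun h0 =>
    hne (mulHomOf (fun _ => 0) fun _ _ => by simp) continuous_const fun x => by
      rw [h0]; exact (mul_zero α).symm
  have scale : ∀ c : ℂ, (∀ x, g x = c * f x) → Continuous g := fun c hc => by
    rw [funext hc]; exact continuous_const.mul hf
  rcases h.family hσ with ⟨-, -, hg⟩ | ⟨-, rfl, -, -⟩ | ⟨-, hfg, -, -⟩ |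
    ⟨q, r, χ, -, -, -, hfχ, hg⟩ | ⟨q, r, χ₁, χ₂, -, hq, hq', hχ, -, -, -, -, hfχ, hg⟩ |
    ⟨hα, χ₁, χ₂, -, -, -, -, -, hfχ, -⟩ | ⟨χ, k, -, -, -, hk, hfχ, hg⟩ |
    ⟨hα, hα', χ, hχ, hfχ, hg⟩
  · exact scale α hg
  · exact hf
  · exact scale (-1) fun x => by simp [hfg]
  · have hq : q + α ≠ 0 := fun hq => hf0 fun x => by rw [hfχ, hq, zero_mul]
    exact scale ((1 + r) / (q + α)) fun x => by rw [hg, hfχ]; field_simp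
  · obtain ⟨c₁, c₂⟩ := continuous_of_lin_mul (k := χ₁) (l := χ₂) (a := (α + q) / 2)
      (b := (α - q) / 2) (map_mul χ₁) (map_mul χ₂) (fun e => hχ (DFunLike.coe_injective e))
      (div_ne_zero (fun e => hq' (by linear_combination e)) two_ne_zero)
      (div_ne_zero (fun e => hq (by linear_combination -e)) two_ne_zero) hf
      (fun x => by rw [hfχ]; ring)
    rw [funext hg]
    fun_prop
  · refine absurd hfχ (hne χ₁ ?_)
    have e : (χ₁ : S → ℂ) = fun x => f x / α := by
      funext x; rw [hfχ]; field_simp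
    rw [e]; exact hf.div_const _
  · have hχ : Continuous χ := by
      by_cases hk0 : ∀ x, k x = 0
      · have hα : α ≠ 0 := fun hα => hf0 fun x => by rw [hfχ, hk0, hα]; ring
        have e : (χ : S → ℂ) = fun x => f x / α := by
          funext x; rw [hfχ, hk0]; field_simp; ring
        rw [e]; exact hf.div_const _
      · push Not at hk0
        obtain ⟨s, hs⟩ := hk0
        -- By the sine law, f(xs) - χ(s)f(x) = k(s)χ(x).
        have e : (χ : S → ℂ) = fun x => (f (x * s) - χ s * f x) / k s := by
          funext x; rw [hfχ, hfχ, hk, map_mul]; field_simp; ring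
        rw [e]
        exact ((hf.comp (continuous_mul_const s)).sub (continuous_const.mul hf)).div_const _
    have hkc : Continuous k := by
      have e : k = fun x => f x - α * χ x := by funext x; rw [hfχ]; ring
      rw [e]; exact hf.sub (continuous_const.mul hχ)
    rcases hg with hg | hg
    · rw [funext hg]; exact hχ.add hkc
    · rw [funext hg]; exact hχ.sub hkc
  -- Treating χ∘σ as a second multiplicative function gives its continuity without continuity of σ.
  · obtain ⟨c₁, c₂⟩ := continuous_of_lin_mul (k := χ) (l := fun x => χ (σ x))
      (a := (1 + α) / 2) (b := -((1 - α) / 2)) (map_mul χ) (fun x y => by simp) hχ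
      (div_ne_zero (fun e => hα' (by linear_combination e)) two_ne_zero)
      (neg_ne_zero.2 (div_ne_zero (fun e => hα (by linear_combination -e)) two_ne_zero)) hf
      (fun x => by rw [hfχ]; ring)
    rw [funext hg]
    exact (continuous_const.mul c₁).add (continuous_const.mul c₂)

end Continuity

end CosineLaw

theorem mainTheorem1 {S : Type*} [Semigroup S] [Nonempty S] (σ : S ≃* S)
    (hσ : Function.Involutive σ) (α : ℂ) :
    (∀ g f : S → ℂ, CosineLaw.IsSolution σ α g f ↔
      CosineLaw.Family1 α g f ∨ CosineLaw.NonExceptional σ α g f) ∧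
    (∀ g f : S → ℂ, CosineLaw.NonExceptional σ α g f →
      CosineLaw.IsAbelian g ∧ CosineLaw.IsAbelian f) ∧
    (∀ [TopologicalSpace S] [ContinuousMul S] (g f : S → ℂ), CosineLaw.IsSolution σ α g f →
      Continuous f →
      (∀ χ : S →ₙ* ℂ, Continuous χ → ¬ ∀ x, f x = α * χ x) →
      Continuous g) := by
  refine ⟨fun g f => ⟨fun h => h.family hσ, ?_⟩, fun g f h => h.isAbelian,
    fun g f h hf hne => h.continuous hσ hf hne⟩
  rintro (h | h)
  · exact h.isSolution
  · exact h.isSolution hσ
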